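/- Theorem. Let $V$ be a finite set of $n\ge 3$ agents and let $K\ge 2$ be a real number. A strategy of an agent $u$ is a finite set $S_u\subseteq V\times\mathbb Z$, where $(v,l)\in S_u$ means that $u$ buys the edge $\{u,v\}$ with label $l$; labels are arbitrary integers. A strategy profile $\mathbf s=(S_u)_{u\in V}$ forms the graph $G(\mathbf s)$ on $V$ whose edges are the bought pairs $\{u,v\}$, $u\ne v$, and the label of an edge is the least label bought for it by either of its endpoints. Let $R_{\mathbf s}(u)$ be the set of vertices that can be reached from $u$ in $G(\mathbf s)$ by a sequence of consecutive edges with strictly increasing labels (so $u\in R_{\mathbf s}(u)$, by the empty sequence). The cost of agent $u$ is $$c(u,\mathbf s)=|S_u|+K\cdot|V\setminus R_{\mathbf s}(u)|,$$ and the social cost is $C(\mathbf s)=\sum_{u\in V}c(u,\mathbf s)$. A profile is a Nash equilibrium if no agent can strictly lower its own cost by changing only its own strategy. (This is the Arbitrary Low Label model with strict paths.) Then the social cost attains a minimum $C(\mathrm{OPT})$ over all profiles, and $C(\mathrm{OPT})>0$. If a Nash equilibrium exists, then the maximum of $C$ over all Nash equilibria is attained, and the price of anarchy satisfies $$\mathrm{PoA}=\frac{\max_{\mathbf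 s\text{ Nash equilibrium}}C(\mathbf s)}{C(\mathrm{OPT})}\le 1+\frac1{n-2}.$$ -/

import Mathlib

namespace TemporalGame

/-- A temporal graph on the vertex set `V`: an undirected simple graph together with integer edge
labels (only the values of `label` on edges of `graph` are ever used). -/
structure TemporalGraph (V : Type*) where
  graph : SimpleGraph V
  label : Sym2 V → ℤ

/-- `v` is reachable from `u` by a sequence of consecutive edges such that the labels of any two
successive edges are related by `r`. Taking `r` to be `<` gives strict temporal paths, taking `≤`
gives non-strict ones. The empty path shows that every vertex reaches itself. -/
def TemporalGraph.Reaches {V : Type*} (G : TemporalGraph V) (r : ℤ → ℤ → Prop) (u v : V) : Prop :=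
  ∃ p : G.graph.Walk u v, (p.edges.map G.label).IsChain r

/-- The set `R_G(u)` of vertices that `u` can reach. -/
def TemporalGraph.reachSet {V : Type*} (G : TemporalGraph V) (r : ℤ → ℤ → Prop) (u : V) : Set V :=
  {v | G.Reaches r u v}

/-- A strategy profile: agent `u` plays the finite set `s u`, and `(v, l) ∈ s u` means that `u`
buys the edge `{u, v}` with the label `l`, which may be any integer. -/
abbrev Profile (V : Type*) := V → Finset (V × ℤ)

/-- The temporal graph formed by a profile. The edges are the bought pairs of distinct agents; the
label of an edge is the least label bought for it by one of its endpoints (the infimum of a finite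
nonempty set of integers, hence a minimum). -/
noncomputable def Profile.toTemporalGraph {V : Type*} (s : Profile V) : TemporalGraph V where
  graph := SimpleGraph.fromRel fun u v => ∃ l : ℤ, (v, l) ∈ s u
  label := fun e => sInf {l : ℤ | ∃ u v : V, s(u, v) = e ∧ (v, l) ∈ s u}

/-- A variant of the game: the relation required between successive labels of a temporal path, the
label cost function `f_s` and the (total) penalty function `P_s`. -/
structure Variant (V : Type*) where
  pathRel : ℤ → ℤ → Prop
  labelCost : Profile V → Sym2 V → ℝ
  penalty : Profile V → V → ℝ

/-- The Arbitrary Low Label model with strict paths: labels strictly increase along paths, all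
labels cost the same, and there is no penalty, so that arbitrarily low labels may be used. -/
def arbitraryLowStrict (V : Type*) : Variant V where
  pathRel := fun a b => a < b
  labelCost := fun _ _ => 0
  penalty := fun _ _ => 0

section Game

variable {V : Type*} [Fintype V] [DecidableEq V]

/-- The cost of agent `u`: number of purchases, plus label costs, plus penalty, plus `K` for every
agent that `u` cannot reach. -/
noncomputable def agentCost (M : Variant V) (K : ℝ) (s : Profile V) (u : V) : ℝ :=
  ((s u).card : ℝ) + ∑ p ∈ s u, M.labelCost s s(u, p.1) + M.penalty s u
    + K * (((s.toTemporalGraph.reachSet M.pathRel u)ᶜ).ncard : ℝ)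

/-- The social cost `C(s)`. -/
noncomputable def socialCost (M : Variant V) (K : ℝ) (s : Profile V) : ℝ :=
  ∑ u : V, agentCost M K s u

/-- No agent can lower its cost by changing only its own strategy. -/
def IsNashEquilibrium (M : Variant V) (K : ℝ) (s : Profile V) : Prop :=
  ∀ (u : V) (S : Finset (V × ℤ)), ¬ agentCost M K (Function.update s u S) u < agentCost M K s u

/-- A profile that minimizes the social cost. -/
def IsSocialOptimum (M : Variant V) (K : ℝ) (s : Profile V) : Prop :=
  ∀ s' : Profile V, socialCost M K s ≤ socialCost M K s'

/-- The price of anarchy: the highest social cost of a Nash equilibrium divided by the least social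
cost of a profile. (It has its usual meaning when that maximum and that minimum exist and the
minimum is positive.) -/
noncomputable def priceOfAnarchy (M : Variant V) (K : ℝ) : ℝ :=
  sSup {c : ℝ | ∃ s : Profile V, IsNashEquilibrium M K s ∧ socialCost M K s = c} /
    sInf {c : ℝ | ∃ s : Profile V, socialCost M K s = c}

end Game

end TemporalGame

/-! Every profile costs at least 2n - 4 and every equilibrium at most 2n - 2; the quotient is 1 +
1/(n - 2).

Lower bound (`le_socialCost`). Making calls along the edges in label order, plus a call for each
pair that is not connected, gives a schedule of telephone calls after which everybody knows
everything. By `gossip` it has at least 2n - 4 calls, and a missing pair costs K ≥ 1, no less than a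
call. The gossip theorem is proved by induction on n. If some information returns to its owner, the
owner can be merged with it, which saves one person and two calls
(`exists_smaller_of_not_noOwnInformation`). Otherwise the calls spreading news of x and the calls
leading to x share only calls of x. With fewer than 2n - 4 calls, everybody then makes at least 3
calls, some x makes exactly 3, and every call serves this x. This forces a connected graph with too
few edges (`two_mul_card_le_of_noOwnInformation`).

Upper bound (`IsNashEquilibrium.socialCost_le`). In equilibrium everybody reaches everybody, as a
direct edge costs 1 < K. Fix the tree of earliest arrivals from a root r. An agent who keeps only
the tree edges it pays for, and buys an edge to r below all other labels, still reaches everybody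
(`reaches_update`). Summing these deviation costs gives n - 1 tree edges and n - 1 edges to r.

Labels are unbounded, so there are infinitely many profiles; the extrema exist because only finitely
many costs lie below a bound. -/

namespace TemporalGame

/-! ### Call schemes, flow of information and time reversal -/

/-- A sequence of telephone calls: at each time in the finite set `times`, the two ends of
`call t` exchange everything they know. -/
structure CallScheme (V : Type*) where
  times : Finset ℤ
  call : ℤ → Sym2 V

namespace CallScheme

variable {V : Type*} (S : CallScheme V)

/-- A trajectory of a piece of information: at each time it stays or moves along the call. -/
def IsTrajectory (f : ℤ → V) : Prop :=
  ∀ t, f t = f (t + 1) ∨ t ∈ S.times ∧ S.call t = s(f t, f (t + 1))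

/-- Information held by `u` before time `s` can be held by `w` before time `t`. -/
def Carries (u : V) (s : ℤ) (w : V) (t : ℤ) : Prop :=
  s ≤ t ∧ ∃ f, S.IsTrajectory f ∧ f s = u ∧ f t = w

/-- Everybody learns everything. -/
def IsComplete : Prop := ∀ u w, ∃ s t, S.Carries u s w t

/-- Nobody calls himself. -/
def IsLoopless : Prop := ∀ t ∈ S.times, ¬ (S.call t).IsDiag

/-- No one hears own information. -/
def NoOwnInformation : Prop :=
  ∀ z y i t, i ∈ S.times → S.call i = s(z, y) → ¬ S.Carries y (i + 1) z t

/-- The scheme run backwards in time. -/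
def reverse : CallScheme V where
  -- A call at t acts between the moments t and t + 1; the reflection t ↦ -t of moments makes it act
  -- between -1 - t and -t.
  times := S.times.image fun t => -1 - t
  call := fun t => S.call (-1 - t)

variable {S}

lemma mem_times_reverse {t : ℤ} : t ∈ S.reverse.times ↔ -1 - t ∈ S.times := by
  simp only [reverse, Finset.mem_image]
  constructor
  · rintro ⟨a, ha, rfl⟩
    simpa using ha
  · intro h
    exact ⟨_, h, by ring⟩

lemma call_reverse (t : ℤ) : S.reverse.call t = S.call (-1 - t) := rfl

@[simp] lemma reverse_reverse : S.reverse.reverse = S := by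
  cases S with
  | mk T c =>
    simp only [reverse, Finset.image_image, mk.injEq]
    refine ⟨?_, ?_⟩
    · ext a
      simp
    · ext a
      simp

lemma IsTrajectory.reverse {f : ℤ → V} (hf : S.IsTrajectory f) :
    S.reverse.IsTrajectory fun t => f (-t) := by
  intro t
  have h := hf (-1 - t)
  have e : -1 - t + 1 = -t := by ring
  have e' : -(t + 1) = -1 - t := by ring
  rw [e] at h
  beta_reduce
  rw [e', mem_times_reverse, call_reverse]
  rcases h with h | ⟨h, h'⟩
  · exact Or.inl h.symm
  · exact Or.inr ⟨h, by rw [h', Sym2.eq_swap]⟩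

lemma Carries.reverse {u w : V} {s t : ℤ} (h : S.Carries u s w t) :
    S.reverse.Carries w (-t) u (-s) := by
  obtain ⟨hst, f, hf, hs, ht⟩ := h
  exact ⟨by omega, _, hf.reverse, by simpa using ht, by simpa using hs⟩

lemma IsComplete.reverse (h : S.IsComplete) : S.reverse.IsComplete := by
  intro u w
  obtain ⟨s, t, h⟩ := h w u
  exact ⟨-t, -s, h.reverse⟩

lemma IsLoopless.reverse (h : S.IsLoopless) : S.reverse.IsLoopless :=
  fun _ ht => h _ (mem_times_reverse.1 ht)

lemma Carries.refl (u : V) (s : ℤ) : S.Carries u s u s :=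
  ⟨le_rfl, fun _ => u, fun _ => Or.inl rfl, rfl, rfl⟩

lemma Carries.wait (u : V) {s t : ℤ} (h : s ≤ t) : S.Carries u s u t :=
  ⟨h, fun _ => u, fun _ => Or.inl rfl, rfl, rfl⟩

lemma IsTrajectory.concat {f g : ℤ → V} (hf : S.IsTrajectory f) (hg : S.IsTrajectory g) {m : ℤ}
    (h : f m = g m) : S.IsTrajectory fun t => if t ≤ m then f t else g t := by
  intro t
  rcases lt_trichotomy t m with ht | rfl | ht
  · have h1 : t ≤ m := by omega
    have h2 : t + 1 ≤ m := by omega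
    simpa [h1, h2] using hf t
  · simpa [h] using hg t
  · have h1 : ¬ t ≤ m := by omega
    have h2 : ¬ t + 1 ≤ m := by omega
    simpa [h1, h2] using hg t

lemma Carries.trans {u v w : V} {s m t : ℤ} (h : S.Carries u s v m) (h' : S.Carries v m w t) :
    S.Carries u s w t := by
  obtain ⟨hsm, f, hf, hs, hm⟩ := h
  obtain ⟨hmt, g, hg, hm', ht⟩ := h'
  refine ⟨by omega, _, hf.concat hg (hm.trans hm'.symm), by simp [hsm, hs], ?_⟩
  rcases hmt.eq_or_lt with rfl | hmt
  · simp [hm, ← ht, hm']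
  · simp [not_le.2 hmt, ht]

lemma Carries.of_call {u w : V} {t : ℤ} (ht : t ∈ S.times) (h : S.call t = s(u, w)) :
    S.Carries u t w (t + 1) := by
  refine ⟨by omega, fun r => if r ≤ t then u else w, fun r => ?_, by simp, by simp⟩
  rcases lt_trichotomy r t with hr | rfl | hr
  · left
    simp [hr.le, show r + 1 ≤ t by omega]
  · right
    simpa [ht] using h
  · left
    simp [not_le.2 hr, show ¬ r + 1 ≤ t by omega]

/-- The two ends of a call know the same after it. -/
lemma Carries.of_mem_call {u w : V} {t : ℤ} (ht : t ∈ S.times) (hu : u ∈ S.call t)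
    (hw : w ∈ S.call t) : S.Carries u t w (t + 1) := by
  by_cases huw : u = w
  · subst huw
    exact Carries.wait u (by omega)
  · exact Carries.of_call ht ((Sym2.mem_and_mem_iff huw).1 ⟨hu, hw⟩)

lemma IsTrajectory.carries {f : ℤ → V} (hf : S.IsTrajectory f) {s t : ℤ} (h : s ≤ t) :
    S.Carries (f s) s (f t) t := ⟨h, f, hf, rfl, rfl⟩

/-- The first time at which a trajectory satisfies a predicate that does not hold at the start. -/
lemma exists_first_time {P : ℤ → Prop} {s t : ℤ} (hst : s ≤ t) (hs : ¬ P s) (ht : P t) :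
    ∃ m, s ≤ m ∧ m < t ∧ P (m + 1) ∧ ∀ r, s ≤ r → r ≤ m → ¬ P r := by
  classical
  obtain ⟨m, ⟨hsm, hm⟩, hmin⟩ := Int.exists_least_of_bdd (P := fun m => s ≤ m ∧ P m)
    ⟨s, fun z hz => hz.1⟩ ⟨t, hst, ht⟩
  have hne : s ≠ m := fun h => hs (h ▸ hm)
  have := hmin t ⟨hst, ht⟩
  refine ⟨m - 1, by omega, by omega, by simpa using hm, fun r hr hrm hP => ?_⟩
  have := hmin r ⟨hr, hP⟩
  omega

lemma Carries.exists_departure {u w : V} {s t : ℤ} (h : S.Carries u s w t) (huw : u ≠ w) :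
    ∃ i y, s ≤ i ∧ i < t ∧ i ∈ S.times ∧ S.call i = s(u, y) ∧ S.Carries y (i + 1) w t := by
  obtain ⟨hst, f, hf, rfl, rfl⟩ := h
  obtain ⟨m, hsm, hmt, hm, hmin⟩ := exists_first_time (P := fun r => f r ≠ f s) hst (by simp)
    huw.symm
  have h0 : f m = f s := not_not.1 (hmin m hsm le_rfl)
  rcases hf m with h | ⟨h, h'⟩
  · exact absurd (h.symm.trans h0) hm
  · exact ⟨m, f (m + 1), hsm, hmt, h, by rw [h', h0], hf.carries (by omega)⟩

lemma Carries.exists_arrival {u w : V} {s t : ℤ} (h : S.Carries u s w t) (huw : u ≠ w) :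
    ∃ i y, s ≤ i ∧ i < t ∧ i ∈ S.times ∧ S.call i = s(y, w) ∧ S.Carries u s y i := by
  obtain ⟨i, y, h1, h2, h3, h4, h5⟩ := h.reverse.exists_departure huw.symm
  refine ⟨-1 - i, y, by omega, by omega, mem_times_reverse.1 h3, ?_, ?_⟩
  · rw [← call_reverse, h4, Sym2.eq_swap]
  · have := h5.reverse
    rw [reverse_reverse] at this
    convert this using 1 <;> ring

/-- A round trip of information read backwards is again a round trip, with its departure and return
calls exchanged. -/
lemma NoOwnInformation.reverse (hS : S.IsLoopless) (h : S.NoOwnInformation) :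
    S.reverse.NoOwnInformation := by
  intro z y i t hi hc hcar
  have hyz : y ≠ z := by
    rintro rfl
    exact hS.reverse i hi (by rw [hc]; simp)
  obtain ⟨j, q, h1, h2, h3, h4, h5⟩ := hcar.exists_arrival hyz
  have h6 := h5.reverse
  rw [reverse_reverse] at h6
  rw [call_reverse] at h4 hc
  rw [mem_times_reverse] at h3 hi
  refine h z q (-1 - j) (-1 - i + 1) h3 (by rw [h4, Sym2.eq_swap]) ?_
  have h7 : S.Carries y (-1 - i) z (-1 - i + 1) :=
    Carries.of_call hi (by rw [hc, Sym2.eq_swap])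
  refine Carries.trans (v := y) (m := -1 - i) ?_ h7
  convert h6 using 1 <;> ring

/-! ### Removing a person who hears own information -/

section Contract

variable {a : V} [DecidableEq V]

/-- Replace `a` by its avatar. -/
def avatarMap (a : V) (av : ℤ → {v // v ≠ a}) (t : ℤ) (v : V) : {v // v ≠ a} :=
  if h : v = a then av t else ⟨v, h⟩

/-- Delete the person `a` and the calls at times `i`, `j`; the remaining calls of `a` are made by
the avatar of `a`. -/
noncomputable def contract (S : CallScheme V) (a : V) (av : ℤ → {v // v ≠ a}) (i j : ℤ) :
    CallScheme {v // v ≠ a} where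
  times := by
    classical
    exact ((S.times.erase i).erase j).filter
      fun t => ¬ ((S.call t).map (avatarMap a av t)).IsDiag
  call := fun t => (S.call t).map (avatarMap a av t)

lemma avatarMap_self (av : ℤ → {v // v ≠ a}) (t : ℤ) : avatarMap a av t a = av t := by
  simp [avatarMap]

lemma avatarMap_of_ne (av : ℤ → {v // v ≠ a}) (t : ℤ) (v : {v // v ≠ a}) :
    avatarMap a av t v = v := by
  simp [avatarMap, v.2]

/-- The avatar holds whatever `a` holds. It stands still during calls of `a`. When it moves, it uses
a call without `a`, hence neither `i` nor `j`, and takes along what rests at `a`. The deleted calls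
join `a` to its own avatar, so nothing is lost with them. -/
lemma contract_carries_step {av : ℤ → {v // v ≠ a}} {i j : ℤ}
    (hav : S.IsTrajectory fun t => (av t : V))
    (hci : S.call i = s(a, (av i : V))) (hcj : S.call j = s(a, (av j : V)))
    {f : ℤ → V} (hf : S.IsTrajectory f) (t : ℤ) :
    (S.contract a av i j).Carries (avatarMap a av t (f t)) t
      (avatarMap a av (t + 1) (f (t + 1))) (t + 1) := by
  have hstay : ∀ t, a ∈ S.call t → av t = av (t + 1) := by
    intro t hat
    rcases hav t with h | ⟨-, h⟩
    · exact Subtype.ext h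
    · rw [h, Sym2.mem_iff] at hat
      rcases hat with h | h
      · exact absurd h.symm (av t).2
      · exact absurd h.symm (av (t + 1)).2
  have hcall : ∀ u w : V, t ∈ S.times → S.call t = s(u, w) → t ≠ i → t ≠ j →
      (S.contract a av i j).Carries (avatarMap a av t u) t (avatarMap a av t w) (t + 1) := by
    intro u w ht hc hi hj
    by_cases hd : avatarMap a av t u = avatarMap a av t w
    · rw [hd]
      exact Carries.wait _ (by omega)
    · refine Carries.of_call ?_ ?_
      · simp [contract, ht, hi, hj, hc, hd]
      · simp [contract, hc]
  rcases hf t with h | ⟨ht, hc⟩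
  · rw [← h]
    by_cases hfa : f t = a
    · rw [hfa, avatarMap_self, avatarMap_self]
      rcases hav t with h | ⟨ht, hc⟩
      · rw [Subtype.ext h]
        exact Carries.wait _ (by omega)
      · have hat : a ∉ S.call t := by
          rw [hc, Sym2.mem_iff]
          rintro (h | h)
          · exact (av t).2 h.symm
          · exact (av (t + 1)).2 h.symm
        have := hcall _ _ ht hc (by rintro rfl; simp [hci] at hat)
          (by rintro rfl; simp [hcj] at hat)
        rwa [avatarMap_of_ne, avatarMap_of_ne] at this
    · simp only [avatarMap, hfa, dite_false]
      exact Carries.wait _ (by omega)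
  · have hnext : avatarMap a av (t + 1) (f (t + 1)) = avatarMap a av t (f (t + 1)) := by
      by_cases hfa : f (t + 1) = a
      · rw [hfa, avatarMap_self, avatarMap_self]
        refine (hstay t ?_).symm
        rw [hc, hfa]
        simp
      · simp [avatarMap, hfa]
    rw [hnext]
    have hremoved : S.call t = s(a, (av t : V)) → avatarMap a av t (f t) = av t ∧
        avatarMap a av t (f (t + 1)) = av t := by
      intro h
      have h' := congrArg (Sym2.map (avatarMap a av t)) (hc.symm.trans h)
      simp only [Sym2.map_mk, avatarMap_self, avatarMap_of_ne] at h'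
      simpa using h'
    by_cases hi : t = i
    · obtain ⟨h1, h2⟩ := hremoved (hi ▸ hci)
      rw [h1, h2]
      exact Carries.wait _ (by omega)
    by_cases hj : t = j
    · obtain ⟨h1, h2⟩ := hremoved (hj ▸ hcj)
      rw [h1, h2]
      exact Carries.wait _ (by omega)
    exact hcall _ _ ht hc hi hj

lemma contract_isComplete {av : ℤ → {v // v ≠ a}} {i j : ℤ}
    (hav : S.IsTrajectory fun t => (av t : V))
    (hci : S.call i = s(a, (av i : V))) (hcj : S.call j = s(a, (av j : V)))
    (hS : S.IsComplete) : (S.contract a av i j).IsComplete := by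
  intro u w
  obtain ⟨s, t, hst, f, hf, hs, ht⟩ := hS u w
  refine ⟨s, t, ?_⟩
  have key : ∀ r, s ≤ r → (S.contract a av i j).Carries (avatarMap a av s (f s)) s
      (avatarMap a av r (f r)) r := by
    intro r hr
    induction r, hr using Int.leInduction with
    | base => exact Carries.refl _ _
    | succ r _ ih => exact ih.trans (contract_carries_step hav hci hcj hf r)
  simpa [hs, ht, avatarMap_of_ne] using key t hst

lemma contract_isLoopless (av : ℤ → {v // v ≠ a}) (i j : ℤ) :
    (S.contract a av i j).IsLoopless := by
  intro t ht
  exact (Finset.mem_filter.1 ht).2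

lemma card_contract_times_le (av : ℤ → {v // v ≠ a}) {i j : ℤ} (hi : i ∈ S.times)
    (hj : j ∈ S.times) (hij : i ≠ j) :
    (S.contract a av i j).times.card + 2 ≤ S.times.card := by
  have h1 : (S.contract a av i j).times.card ≤ ((S.times.erase i).erase j).card :=
    Finset.card_le_card (Finset.filter_subset _ _)
  have h2 := Finset.card_erase_add_one hi
  have h3 := Finset.card_erase_add_one (Finset.mem_erase.2 ⟨hij.symm, hj⟩)
  omega

/-- Somebody who hears his own information can be deleted together with two calls. -/
lemma exists_smaller_of_not_noOwnInformation (hL : S.IsLoopless) (hS : S.IsComplete)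
    (h : ¬ S.NoOwnInformation) : ∃ (a : V) (S' : CallScheme {v // v ≠ a}),
      S'.IsLoopless ∧ S'.IsComplete ∧ S'.times.card + 2 ≤ S.times.card := by
  simp only [NoOwnInformation, not_forall, not_not] at h
  obtain ⟨a, y, i, t, hi, hci, hit, f, hf, hfi, hft⟩ := h
  have hya : y ≠ a := by
    rintro rfl
    exact hL i hi (by rw [hci]; simp)
  obtain ⟨j, hij, hjt, hj, hmin⟩ := exists_first_time (P := fun r => f r = a) hit
    (by simpa [hfi] using hya) hft
  have hjT : j ∈ S.times ∧ S.call j = s(f j, a) := by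
    rcases hf j with h | h
    · exact absurd (h.trans hj) (hmin j hij le_rfl)
    · rwa [hj] at h
  -- The avatar follows the returning information from `i + 1` until its first return through call
  -- `j`, where it avoids `a`, and is constant outside this interval.
  let av : ℤ → {v // v ≠ a} := fun r => ⟨f (max (i + 1) (min r j)), hmin _ (by omega) (by omega)⟩
  have hav : S.IsTrajectory fun t => (av t : V) := by
    intro r
    simp only [av]
    by_cases h1 : i + 1 ≤ r
    · by_cases h2 : r < j
      · rw [show max (i + 1) (min r j) = r by omega,
          show max (i + 1) (min (r + 1) j) = r + 1 by omega]
        exact hf r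
      · left
        congr 1
        omega
    · left
      congr 1
      omega
  have hci' : S.call i = s(a, (av i : V)) := by
    rw [hci, ← hfi]
    simp only [av]
    rw [show max (i + 1) (min i j) = i + 1 by omega]
  have hcj' : S.call j = s(a, (av j : V)) := by
    rw [hjT.2, Sym2.eq_swap]
    simp only [av]
    rw [show max (i + 1) (min j j) = j by omega]
  exact ⟨a, S.contract a av i j, contract_isLoopless _ _ _,
    contract_isComplete hav hci' hcj' hS, card_contract_times_le av hi hjT.1 (by omega)⟩

end Contract

/-! ### Counting the calls useful to one person -/

open Classical in
/-- The calls that carry information of `x`. -/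
noncomputable def outCalls (S : CallScheme V) (x : V) : Finset ℤ :=
  S.times.filter fun t => ∃ p ∈ S.call t, ∃ s, S.Carries x s p t

open Classical in
/-- The calls whose information reaches `x`. -/
noncomputable def inCalls (S : CallScheme V) (x : V) : Finset ℤ :=
  S.times.filter fun t => ∃ p ∈ S.call t, ∃ r, S.Carries p (t + 1) x r

open Classical in
/-- The calls made by `x`. -/
noncomputable def callsOf (S : CallScheme V) (x : V) : Finset ℤ :=
  S.times.filter fun t => x ∈ S.call t

lemma mem_outCalls {x : V} {t : ℤ} :
    t ∈ S.outCalls x ↔ t ∈ S.times ∧ ∃ p ∈ S.call t, ∃ s, S.Carries x s p t := by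
  simp [outCalls]

lemma mem_inCalls {x : V} {t : ℤ} :
    t ∈ S.inCalls x ↔ t ∈ S.times ∧ ∃ p ∈ S.call t, ∃ r, S.Carries p (t + 1) x r := by
  simp [inCalls]

lemma mem_callsOf {x : V} {t : ℤ} : t ∈ S.callsOf x ↔ t ∈ S.times ∧ x ∈ S.call t := by
  simp [callsOf]

lemma inCalls_subset_reverse {x : V} {t : ℤ} (h : t ∈ S.inCalls x) :
    -1 - t ∈ S.reverse.outCalls x := by
  rw [mem_inCalls] at h
  obtain ⟨ht, p, hp, r, h⟩ := h
  rw [mem_outCalls, mem_times_reverse, call_reverse]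
  refine ⟨by simpa using ht, p, by simpa using hp, -r, ?_⟩
  convert h.reverse using 1
  ring

lemma outCalls_subset_reverse {x : V} {t : ℤ} (h : t ∈ S.outCalls x) :
    -1 - t ∈ S.reverse.inCalls x := by
  rw [mem_outCalls] at h
  obtain ⟨ht, p, hp, r, h⟩ := h
  rw [mem_inCalls, mem_times_reverse, call_reverse]
  refine ⟨by simpa using ht, p, by simpa using hp, -r, ?_⟩
  convert h.reverse using 1
  ring

lemma reverse_mem_callsOf {x : V} {t : ℤ} : t ∈ S.reverse.callsOf x ↔ -1 - t ∈ S.callsOf x := by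
  rw [mem_callsOf, mem_callsOf, mem_times_reverse, call_reverse]

section Count

variable [Fintype V]

/-- Charge to each w ≠ x the first call by which w hears of x. Two people cannot share such a call,
since one of its ends already knew. -/
lemma card_le_card_outCalls (hS : S.IsComplete) (x : V) :
    Fintype.card V ≤ (S.outCalls x).card + 1 := by
  classical
  have key : ∀ w, x ≠ w → ∃ t ∈ S.times, (∃ p s, S.call t = s(p, w) ∧ S.Carries x s p t) ∧
      ∀ s, ¬ S.Carries x s w t := by
    intro w hxw
    let C := S.times.filter fun t => ∃ p s, S.call t = s(p, w) ∧ S.Carries x s p t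
    have hC : C.Nonempty := by
      obtain ⟨s, t, h⟩ := hS x w
      obtain ⟨i, y, -, -, h3, h4, h5⟩ := h.exists_arrival hxw
      exact ⟨i, Finset.mem_filter.2 ⟨h3, y, s, h4, h5⟩⟩
    obtain ⟨t, ht, hmin⟩ := C.exists_min_image id hC
    refine ⟨t, (Finset.mem_filter.1 ht).1, (Finset.mem_filter.1 ht).2, fun s h => ?_⟩
    obtain ⟨i, y, -, h2, h3, h4, h5⟩ := h.exists_arrival hxw
    have := hmin i (Finset.mem_filter.2 ⟨h3, y, s, h4, h5⟩)
    simp only [id] at this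
    omega
  choose! τ hτ hc hn using key
  have hcard : (Finset.univ.erase x).card ≤ (S.outCalls x).card := by
    refine Finset.card_le_card_of_injOn τ ?_ ?_
    · intro w hw
      have hxw : x ≠ w := (Finset.ne_of_mem_erase hw).symm
      obtain ⟨p, s, h1, h2⟩ := hc w hxw
      exact mem_outCalls.2 ⟨hτ w hxw, p, by rw [h1]; simp, s, h2⟩
    · intro w hw w' hw' h
      have hxw : x ≠ w := (Finset.ne_of_mem_erase hw).symm
      have hxw' : x ≠ w' := (Finset.ne_of_mem_erase hw').symm
      obtain ⟨p, s, h1, h2⟩ := hc w hxw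
      obtain ⟨p', s', h1', h2'⟩ := hc w' hxw'
      rw [h, h1', Sym2.eq_iff] at h1
      rcases h1 with ⟨-, h1⟩ | ⟨h1, -⟩
      · exact h1.symm
      · refine absurd ?_ (hn w hxw s')
        rw [h, ← h1]
        exact h2'
  rw [Finset.card_erase_of_mem (Finset.mem_univ x), Finset.card_univ] at hcard
  omega

lemma card_le_card_inCalls (hS : S.IsComplete) (x : V) :
    Fintype.card V ≤ (S.inCalls x).card + 1 := by
  have h := card_le_card_outCalls hS.reverse x
  have h' : (S.reverse.outCalls x).card ≤ (S.inCalls x).card := by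
    refine Finset.card_le_card_of_injOn (fun t => -1 - t) ?_ ?_
    · intro t ht
      have := outCalls_subset_reverse (Finset.mem_coe.1 ht)
      rwa [reverse_reverse] at this
    · intro t _ t' _ h
      simp only at h
      omega
  omega

-- If x took no part in such a call, its information would leave x, pass through the call and come
-- back to x.
omit [Fintype V] in
lemma inCalls_inter_outCalls_subset [DecidableEq V] (hN : S.NoOwnInformation) (x : V) :
    S.outCalls x ∩ S.inCalls x ⊆ S.callsOf x := by
  intro t ht
  rw [Finset.mem_inter, mem_outCalls, mem_inCalls] at ht
  obtain ⟨⟨htT, p, hp, s, hxp⟩, -, r, hr, t', hrx⟩ := ht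
  rw [mem_callsOf]
  refine ⟨htT, ?_⟩
  by_contra hx
  have hxp' : x ≠ p := fun h => hx (h ▸ hp)
  obtain ⟨i, y, -, -, hi, hc, h⟩ := hxp.exists_departure hxp'
  exact hN x y i t' hi hc ((h.trans (Carries.of_mem_call htT hp hr)).trans hrx)

/-- Without own information, nearly all calls are useful for everybody. -/
lemma two_mul_card_le [DecidableEq V] (hS : S.IsComplete) (hN : S.NoOwnInformation) (x : V) :
    2 * Fintype.card V ≤ (S.outCalls x ∪ S.inCalls x).card + (S.callsOf x).card + 2 := by
  have h1 := card_le_card_outCalls hS x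
  have h2 := card_le_card_inCalls hS x
  have h3 := Finset.card_union_add_card_inter (S.outCalls x) (S.inCalls x)
  have h4 := Finset.card_le_card (inCalls_inter_outCalls_subset hN x)
  omega

omit [Fintype V] in
lemma outCalls_union_inCalls_subset (x : V) : S.outCalls x ∪ S.inCalls x ⊆ S.times := by
  intro t ht
  rw [Finset.mem_union, mem_outCalls, mem_inCalls] at ht
  exact ht.elim And.left And.left

lemma sum_card_callsOf_le : ∑ x, (S.callsOf x).card ≤ 2 * S.times.card := by
  classical
  have h : ∑ x, (S.callsOf x).card = ∑ t ∈ S.times, (Finset.univ.filter (· ∈ S.call t)).card := by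
    simp only [callsOf, Finset.card_filter]
    exact Finset.sum_comm
  rw [h, mul_comm, ← smul_eq_mul]
  refine Finset.sum_le_card_nsmul _ _ _ fun t _ => ?_
  induction S.call t using Sym2.ind with
  | _ a b =>
    refine (Finset.card_le_card (t := {a, b}) ?_).trans Finset.card_le_two
    intro v
    simp

end Count

/-! ### First, last and middle calls; the gossip theorem -/

/-- The first call of `x`. -/
def IsFirst (S : CallScheme V) (x : V) (t : ℤ) : Prop :=
  t ∈ S.callsOf x ∧ ∀ t' ∈ S.callsOf x, t ≤ t'

/-- The last call of `x`. -/
def IsLast (S : CallScheme V) (x : V) (t : ℤ) : Prop :=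
  t ∈ S.callsOf x ∧ ∀ t' ∈ S.callsOf x, t' ≤ t

lemma isFirst_reverse {x : V} {t : ℤ} : S.reverse.IsFirst x t ↔ S.IsLast x (-1 - t) := by
  simp only [IsFirst, IsLast, reverse_mem_callsOf]
  refine and_congr_right fun _ => ⟨fun h t' ht' => ?_, fun h t' ht' => ?_⟩
  · have := h (-1 - t') (by simpa using ht')
    omega
  · have := h _ ht'
    omega

lemma isLast_reverse {x : V} {t : ℤ} : S.reverse.IsLast x t ↔ S.IsFirst x (-1 - t) := by
  have := isFirst_reverse (S := S.reverse) (x := x) (t := -1 - t)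
  rw [reverse_reverse] at this
  rw [this]
  simp

/-- Without own information, first calls are first calls for both sides. -/
lemma IsFirst.of_mem (hS : S.IsComplete) (hN : S.NoOwnInformation) {x y : V}
    {t : ℤ} (h : S.IsFirst x t) (hy : y ∈ S.call t) : S.IsFirst y t := by
  obtain ⟨ht, hmin⟩ := h
  have htT := (mem_callsOf.1 ht).1
  have hxt := (mem_callsOf.1 ht).2
  refine ⟨mem_callsOf.2 ⟨htT, hy⟩, fun f hf => ?_⟩
  by_contra! hlt
  obtain ⟨hfT, hyf⟩ := mem_callsOf.1 hf
  obtain ⟨z, hz⟩ := hyf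
  have hxz : x ≠ z := by
    rintro rfl
    have := hmin f (mem_callsOf.2 ⟨hfT, by rw [hz]; simp⟩)
    omega
  obtain ⟨s, r, hc⟩ := hS x z
  obtain ⟨i, q, -, -, hi, hci, hq⟩ := hc.exists_departure hxz
  have hti := hmin i (mem_callsOf.2 ⟨hi, by rw [hci]; simp⟩)
  -- z tells y at `f`, y meets x at `t`, and what x knows after its first call reaches z: z would
  -- hear own information.
  refine hN z y f r hfT (by rw [hz, Sym2.eq_swap]) ?_
  have h1 : S.Carries y (f + 1) y t := Carries.wait y (by omega)
  refine h1.trans ?_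
  rcases hti.eq_or_lt with rfl | hti
  · exact (Carries.of_mem_call htT hy (by rw [hci]; simp)).trans hq
  · refine (Carries.of_mem_call htT hy hxt).trans ?_
    refine (Carries.wait x (show t + 1 ≤ i by omega)).trans ?_
    exact (Carries.of_call hi hci).trans hq

lemma IsLast.of_mem (hL : S.IsLoopless) (hS : S.IsComplete) (hN : S.NoOwnInformation) {x y : V}
    {t : ℤ} (h : S.IsLast x t) (hy : y ∈ S.call t) : S.IsLast y t := by
  have h' : S.reverse.IsFirst x (-1 - t) := isFirst_reverse.2 (by simpa using h)
  have := isFirst_reverse.1 (h'.of_mem hS.reverse (hN.reverse hL) (y := y)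
    (by rw [call_reverse]; simpa using hy))
  simpa using this

open Classical in
/-- Calls that are neither first nor last calls. -/
noncomputable def middleCalls (S : CallScheme V) : Finset ℤ :=
  S.times.filter fun t => ∀ v, ¬ S.IsFirst v t ∧ ¬ S.IsLast v t

lemma mem_middleCalls {t : ℤ} :
    t ∈ S.middleCalls ↔ t ∈ S.times ∧ ∀ v, ¬ S.IsFirst v t ∧ ¬ S.IsLast v t := by
  simp [middleCalls]

lemma mem_middleCalls_reverse {t : ℤ} : t ∈ S.reverse.middleCalls ↔ -1 - t ∈ S.middleCalls := by
  simp only [mem_middleCalls, mem_times_reverse, isFirst_reverse, isLast_reverse]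
  refine and_congr_right fun _ => forall_congr' fun v => and_comm

/-- The graph of the middle calls and the first and last calls of `x`. -/
def middleGraph (S : CallScheme V) (x : V) : SimpleGraph V :=
  SimpleGraph.fromEdgeSet
    {e | ∃ t, (t ∈ S.middleCalls ∨ S.IsFirst x t ∨ S.IsLast x t) ∧ S.call t = e}

lemma middleGraph_reverse (x : V) : S.reverse.middleGraph x = S.middleGraph x := by
  unfold middleGraph
  congr 1
  ext e
  simp only [mem_middleCalls_reverse, isFirst_reverse, isLast_reverse, call_reverse,
    Set.mem_ofPred_eq]
  constructor
  · rintro ⟨t, h1, h2⟩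
    exact ⟨-1 - t, by tauto, h2⟩
  · rintro ⟨t, h1, h2⟩
    exact ⟨-1 - t, by simp; tauto, by simpa using h2⟩

lemma middleGraph_reachable_of_call {x u w : V} {t : ℤ}
    (ht : t ∈ S.middleCalls ∨ S.IsFirst x t ∨ S.IsLast x t) (h : S.call t = s(u, w)) :
    (S.middleGraph x).Reachable u w := by
  by_cases huw : u = w
  · rw [huw]
  · exact SimpleGraph.Adj.reachable
      ((SimpleGraph.fromEdgeSet_adj _).2 ⟨⟨t, ht, h⟩, huw⟩)

lemma Carries.exists_mem_callsOf {u w : V} {s t : ℤ} (h : S.Carries u s w t)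
    (ht : t ∈ S.callsOf w) : ∃ t' ∈ S.callsOf u, s ≤ t' := by
  by_cases huw : u = w
  · exact ⟨t, huw ▸ ht, h.1⟩
  · obtain ⟨i, y, h1, -, h3, h4, -⟩ := h.exists_departure huw
    exact ⟨i, mem_callsOf.2 ⟨h3, by rw [h4]; simp⟩, h1⟩

/-- Information of `x` on its way to a further call stays in the graph of middle calls. -/
lemma Carries.middleGraph_reachable (hL : S.IsLoopless) (hS : S.IsComplete)
    (hN : S.NoOwnInformation) {x p : V} {s t : ℤ} (h : S.Carries x s p t)
    (ht : t ∈ S.callsOf p) : (S.middleGraph x).Reachable x p := by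
  obtain ⟨hst, f, hf, hs, hp⟩ := h
  have key : ∀ r, s ≤ r → r ≤ t → (S.middleGraph x).Reachable x (f r) := by
    intro r hr
    induction r, hr using Int.leInduction with
    | base => intro _; rw [hs]
    | succ r hsr ih =>
      intro hrt
      have ih := ih (by omega)
      rcases hf r with h | ⟨hrT, hc⟩
      · rwa [← h]
      refine ih.trans ?_
      by_cases hfirst : ∃ v, S.IsFirst v r
      · obtain ⟨v, hv⟩ := hfirst
        have hv' : S.IsFirst (f r) r := hv.of_mem hS hN (by rw [hc]; simp)
        -- Anyone else holding information of x has received it in an earlier call, so cannot be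
        -- making a first call.
        have hx : x = f r := by
          by_contra hne
          have hcar : S.Carries x s (f r) r := hs ▸ hf.carries hsr
          obtain ⟨i, y, -, h2, h3, h4, -⟩ := hcar.exists_arrival hne
          have := hv'.2 i (mem_callsOf.2 ⟨h3, by rw [h4]; simp⟩)
          omega
        exact middleGraph_reachable_of_call (Or.inr (Or.inl (hx ▸ hv'))) hc
      · refine middleGraph_reachable_of_call (Or.inl (mem_middleCalls.2 ⟨hrT, fun v => ⟨?_, ?_⟩⟩)) hc
        · exact fun h => hfirst ⟨v, h⟩
        · intro hlast
          -- The receiver still has a later call, either to pass the information on or the call at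
          -- `t` itself.
          have hl : S.IsLast (f (r + 1)) r := hlast.of_mem hL hS hN (by rw [hc]; simp)
          have hcar : S.Carries (f (r + 1)) (r + 1) p t := hp ▸ hf.carries hrt
          obtain ⟨t', ht', hle⟩ := hcar.exists_mem_callsOf ht
          have := hl.2 t' ht'
          omega
  exact hp ▸ key t hst le_rfl

lemma middleGraph_reachable_of_mem_outCalls (hL : S.IsLoopless) (hS : S.IsComplete)
    (hN : S.NoOwnInformation) {x v : V} {t : ℤ} (ht : t ∈ S.middleCalls) (hv : v ∈ S.call t)
    (hx : t ∈ S.outCalls x) : (S.middleGraph x).Reachable x v := by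
  obtain ⟨htT, p, hp, s, hc⟩ := mem_outCalls.1 hx
  have h1 := hc.middleGraph_reachable hL hS hN (mem_callsOf.2 ⟨htT, hp⟩)
  by_cases hpv : p = v
  · exact hpv ▸ h1
  · exact h1.trans (middleGraph_reachable_of_call (Or.inl ht)
      ((Sym2.mem_and_mem_iff hpv).1 ⟨hp, hv⟩))

lemma middleGraph_reachable_of_mem_inCalls (hL : S.IsLoopless) (hS : S.IsComplete)
    (hN : S.NoOwnInformation) {x v : V} {t : ℤ} (ht : t ∈ S.middleCalls) (hv : v ∈ S.call t)
    (hx : t ∈ S.inCalls x) : (S.middleGraph x).Reachable x v := by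
  rw [← middleGraph_reverse]
  exact middleGraph_reachable_of_mem_outCalls hL.reverse hS.reverse (hN.reverse hL)
    (mem_middleCalls_reverse.2 (by simpa using ht)) (by rw [call_reverse]; simpa using hv)
    (inCalls_subset_reverse hx)

lemma exists_isFirst {x : V} (h : (S.callsOf x).Nonempty) : ∃ t, S.IsFirst x t := by
  obtain ⟨t, ht, hmin⟩ := (S.callsOf x).exists_min_image id h
  exact ⟨t, ht, hmin⟩

lemma exists_isLast {x : V} (h : (S.callsOf x).Nonempty) : ∃ t, S.IsLast x t := by
  obtain ⟨t, ht, hmax⟩ := (S.callsOf x).exists_max_image id h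
  exact ⟨t, ht, hmax⟩

lemma IsFirst.unique {x : V} {t t' : ℤ} (h : S.IsFirst x t) (h' : S.IsFirst x t') : t = t' :=
  le_antisymm (h.2 _ h'.1) (h'.2 _ h.1)

lemma IsLast.unique {x : V} {t t' : ℤ} (h : S.IsLast x t) (h' : S.IsLast x t') : t = t' :=
  le_antisymm (h'.2 _ h.1) (h.2 _ h'.1)

/-- Choosing for everybody one of his calls, at least half as many calls are chosen. -/
lemma card_le_two_mul_card_image [Fintype V] [DecidableEq V] {τ : V → ℤ}
    (h : ∀ v, τ v ∈ S.callsOf v) : Fintype.card V ≤ 2 * (Finset.univ.image τ).card := by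
  rw [← Finset.card_univ]
  refine Finset.card_le_mul_card_image _ _ fun t _ => ?_
  refine (Finset.card_le_card (t := Finset.univ.filter (· ∈ S.call t)) ?_).trans ?_
  · intro v hv
    simp only [Finset.mem_filter, Finset.mem_univ, true_and] at hv ⊢
    exact hv ▸ (mem_callsOf.1 (h v)).2
  · induction S.call t using Sym2.ind with
    | _ a b =>
      refine (Finset.card_le_card (t := {a, b}) ?_).trans Finset.card_le_two
      intro v
      simp

lemma two_mul_card_le_of_noOwnInformation [Fintype V] [Nonempty V] (hL : S.IsLoopless)
    (hS : S.IsComplete) (hN : S.NoOwnInformation) : 2 * Fintype.card V ≤ S.times.card + 4 := by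
  classical
  by_contra! hlt
  have hdeg : ∀ x, 3 ≤ (S.callsOf x).card := by
    intro x
    have h1 := two_mul_card_le hS hN x
    have h2 := Finset.card_le_card (outCalls_union_inCalls_subset (S := S) x)
    omega
  -- There are at most 2n - 5 calls, so the numbers of calls per person sum to at most 4n - 10 < 4n.
  obtain ⟨x, hx⟩ : ∃ x, (S.callsOf x).card ≤ 3 := by
    by_contra! h
    have h1 := sum_card_callsOf_le (S := S)
    have h2 : ∑ _x : V, 4 ≤ ∑ x, (S.callsOf x).card := Finset.sum_le_sum fun x _ => h x
    simp only [Finset.sum_const, Finset.card_univ, smul_eq_mul] at h2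
    omega
  have huse : S.outCalls x ∪ S.inCalls x = S.times := by
    refine Finset.eq_of_subset_of_card_le (outCalls_union_inCalls_subset x) ?_
    have := two_mul_card_le hS hN x
    omega
  have hne : ∀ v, (S.callsOf v).Nonempty := fun v => Finset.card_pos.1 (by have := hdeg v; omega)
  choose φ hφ using fun v => exists_isFirst (hne v)
  choose ψ hψ using fun v => exists_isLast (hne v)
  have hmiddle : S.middleCalls =
      S.times \ (Finset.univ.image φ ∪ Finset.univ.image ψ) := by
    ext t
    simp only [mem_middleCalls, Finset.mem_sdiff, Finset.mem_union, Finset.mem_image,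
      Finset.mem_univ, true_and, not_or, not_exists]
    refine and_congr_right fun _ => ⟨fun h => ⟨fun v hv => (h v).1 (hv ▸ hφ v),
      fun v hv => (h v).2 (hv ▸ hψ v)⟩, fun h v => ⟨fun hv => h.1 v ((hφ v).unique hv),
      fun hv => h.2 v ((hψ v).unique hv)⟩⟩
  have hdisj : Disjoint (Finset.univ.image φ) (Finset.univ.image ψ) := by
    rw [Finset.disjoint_left]
    intro t h1 h2
    simp only [Finset.mem_image, Finset.mem_univ, true_and] at h1 h2
    obtain ⟨v, rfl⟩ := h1
    obtain ⟨w, hw⟩ := h2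
    have h1 : S.IsLast v (φ v) :=
      (hw ▸ hψ w : S.IsLast w (φ v)).of_mem hL hS hN (mem_callsOf.1 (hφ v).1).2
    have h2 : S.callsOf v ⊆ {φ v} := fun t ht =>
      Finset.mem_singleton.2 (le_antisymm (h1.2 t ht) ((hφ v).2 t ht))
    have h3 := Finset.card_le_card h2
    have := hdeg v
    simp at h3
    omega
  -- First calls, and likewise last calls, number at least n/2, as each serves at most two people.
  -- At most n - 5 middle calls remain.
  have hcard : S.middleCalls.card + Fintype.card V ≤ S.times.card := by
    have h1 := card_le_two_mul_card_image (fun v => (hφ v).1)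
    have h2 := card_le_two_mul_card_image (fun v => (hψ v).1)
    have h3 := Finset.card_union_of_disjoint hdisj
    have h4 : Finset.univ.image φ ∪ Finset.univ.image ψ ⊆ S.times := by
      intro t ht
      simp only [Finset.mem_union, Finset.mem_image, Finset.mem_univ, true_and] at ht
      rcases ht with ⟨v, rfl⟩ | ⟨v, rfl⟩
      · exact (mem_callsOf.1 (hφ v).1).1
      · exact (mem_callsOf.1 (hψ v).1).1
    have h5 := Finset.card_sdiff_add_card_eq_card h4
    rw [← hmiddle] at h5
    omega
  -- With three calls, v has a middle one, and it serves x; so v is connected to x.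
  have hreach : ∀ v, (S.middleGraph x).Reachable x v := by
    intro v
    obtain ⟨t, ht⟩ : ∃ t, t ∈ S.callsOf v \ {φ v, ψ v} := by
      refine Finset.card_pos.1 ?_
      have h1 := Finset.le_card_sdiff {φ v, ψ v} (S.callsOf v)
      have h2 := Finset.card_le_two (a := φ v) (b := ψ v)
      have := hdeg v
      omega
    simp only [Finset.mem_sdiff, Finset.mem_insert, Finset.mem_singleton, not_or] at ht
    obtain ⟨ht, ht1, ht2⟩ := ht
    obtain ⟨htT, hvt⟩ := mem_callsOf.1 ht
    have hmid : t ∈ S.middleCalls := by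
      refine mem_middleCalls.2 ⟨htT, fun w => ⟨fun h => ?_, fun h => ?_⟩⟩
      · exact ht1 ((h.of_mem hS hN hvt).unique (hφ v))
      · exact ht2 ((h.of_mem hL hS hN hvt).unique (hψ v))
    have := huse ▸ htT
    rcases Finset.mem_union.1 this with h | h
    · exact middleGraph_reachable_of_mem_outCalls hL hS hN hmid hvt h
    · exact middleGraph_reachable_of_mem_inCalls hL hS hN hmid hvt h
  have hconn : (S.middleGraph x).Connected := by
    have : Nonempty V := ⟨x⟩
    exact ⟨fun u v => (hreach u).symm.trans (hreach v)⟩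
  -- The bound is at most n - 3, while a connected graph on n vertices has at least n - 1 edges.
  have hedges : Nat.card (S.middleGraph x).edgeSet ≤ S.middleCalls.card + 2 := by
    have hsub : (S.middleGraph x).edgeSet ⊆
        ((S.middleCalls ∪ {φ x, ψ x}).image S.call : Finset (Sym2 V)) := by
      intro e he
      rw [middleGraph, SimpleGraph.edgeSet_fromEdgeSet] at he
      obtain ⟨⟨t, ht, rfl⟩, -⟩ := he
      refine Finset.mem_coe.2 (Finset.mem_image_of_mem _ ?_)
      simp only [Finset.mem_union, Finset.mem_insert, Finset.mem_singleton]
      rcases ht with h | h | h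
      · exact Or.inl h
      · exact Or.inr (Or.inl (h.unique (hφ x)))
      · exact Or.inr (Or.inr (h.unique (hψ x)))
    have h1 := Set.ncard_le_ncard hsub (Finset.finite_toSet _)
    rw [Set.ncard_coe_finset] at h1
    have h2 : ((S.middleCalls ∪ {φ x, ψ x}).image S.call).card ≤ _ := Finset.card_image_le
    have h3 := Finset.card_union_le S.middleCalls {φ x, ψ x}
    have h4 := Finset.card_le_two (a := φ x) (b := ψ x)
    rw [Nat.card_coe_set_eq]
    omega
  have := hconn.card_vert_le_card_edgeSet_add_one
  rw [Nat.card_eq_fintype_card] at this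
  omega

/-- The gossip theorem. -/
theorem gossip {V : Type*} [Fintype V] {S : CallScheme V} (hL : S.IsLoopless)
    (hS : S.IsComplete) : 2 * Fintype.card V ≤ S.times.card + 4 := by
  classical
  induction hn : Fintype.card V generalizing V with
  | zero => omega
  | succ n ih =>
    by_cases hN : S.NoOwnInformation
    · have : Nonempty V := Fintype.card_pos_iff.1 (by omega)
      have := two_mul_card_le_of_noOwnInformation hL hS hN
      omega
    · obtain ⟨a, S', hL', hS', hcard⟩ := exists_smaller_of_not_noOwnInformation hL hS hN
      have := ih hL' hS' (by rw [Fintype.card_subtype_compl, hn]; simp)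
      omega

end CallScheme

/-! ### The social cost is at least 2n - 4 -/

section LowerBound

variable {V : Type*} [Fintype V]

/-- A temporal graph with `m` edges in which `d` ordered pairs are not connected satisfies
`2 n - 4 ≤ m + d`. -/
lemma TemporalGraph.two_mul_card_le (G : TemporalGraph V) :
    2 * Fintype.card V ≤
      G.graph.edgeSet.ncard + ∑ u, ((G.reachSet (fun a b => a < b) u)ᶜ).ncard + 4 := by
  classical
  rcases isEmpty_or_nonempty V with hV | hV
  · simp
  have : Nonempty (Sym2 V) := hV.map fun v => s(v, v)
  let N : ℤ := Fintype.card (Sym2 V)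
  let g : Sym2 V ≃ Fin (Fintype.card (Sym2 V)) := Fintype.equivFin _
  -- Distinct times refining the order of labels: the index of a pair is below `N`, so it only
  -- breaks ties.
  let time : Sym2 V → ℤ := fun e => G.label e * N + (g e : ℕ)
  have hg : ∀ e, 0 ≤ ((g e : ℕ) : ℤ) ∧ ((g e : ℕ) : ℤ) < N := fun e =>
    ⟨by positivity, Int.ofNat_lt.2 (g e).2⟩
  have htime : ∀ e e', G.label e < G.label e' → time e + 1 ≤ time e' := by
    intro e e' h
    have h1 : (G.label e + 1) * N ≤ G.label e' * N :=
      mul_le_mul_of_nonneg_right h (by positivity)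
    have h2 := hg e
    have h3 := hg e'
    simp only [time]
    linarith
  have hinj : Function.Injective time := by
    intro e e' h
    rcases lt_trichotomy (G.label e) (G.label e') with hl | hl | hl
    · have := htime _ _ hl
      omega
    · simp only [time, hl] at h
      exact g.injective (Fin.ext (by omega))
    · have := htime _ _ hl
      omega
  -- Each unreached pair gets a direct call; its time does not matter.
  let U : Finset (Sym2 V) := Finset.univ.biUnion fun u =>
    (G.reachSet (fun a b => a < b) u)ᶜ.toFinset.image fun v => s(u, v)
  let E : Finset (Sym2 V) := G.graph.edgeSet.toFinset ∪ U
  let S : CallScheme V := ⟨E.image time, Function.invFun time⟩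
  have hcall : ∀ e, S.call (time e) = e := Function.leftInverse_invFun hinj
  have hmem : ∀ e ∈ E, time e ∈ S.times := fun e he => Finset.mem_image_of_mem _ he
  have hself : ∀ u : V, u ∈ G.reachSet (fun a b => a < b) u := fun u => ⟨.nil, by simp⟩
  have hL : S.IsLoopless := by
    intro t ht
    obtain ⟨e, he, rfl⟩ := Finset.mem_image.1 ht
    rw [hcall]
    rcases Finset.mem_union.1 he with he | he
    · exact G.graph.not_isDiag_of_mem_edgeSet (Set.mem_toFinset.1 he)
    · simp only [U, Finset.mem_biUnion, Finset.mem_univ, true_and, Finset.mem_image,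
        Set.mem_toFinset] at he
      obtain ⟨u, v, hv, rfl⟩ := he
      rw [Sym2.mk_isDiag_iff]
      rintro rfl
      exact hv (hself u)
  have hwalk : ∀ (u v : V) (p : G.graph.Walk u v),
      (p.edges.map G.label).IsChain (fun a b => a < b) →
      ∀ t, (∀ e ∈ p.edges.head?, t ≤ time e) → ∃ t', S.Carries u t v t' := by
    intro u v p
    induction p with
    | nil => exact fun _ t _ => ⟨t, CallScheme.Carries.refl _ _⟩
    | @cons u w v h p ih =>
      intro hc t ht
      rw [SimpleGraph.Walk.edges_cons, List.map_cons, List.isChain_cons] at hc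
      have ht' := ht s(u, w) (by simp)
      obtain ⟨t', h'⟩ := ih hc.2 (time s(u, w) + 1) (fun e he => htime _ _ (hc.1 _ (by
        rw [List.head?_map]
        exact Option.mem_map_of_mem _ he)))
      refine ⟨t', (CallScheme.Carries.wait u ht').trans (CallScheme.Carries.trans ?_ h')⟩
      exact CallScheme.Carries.of_call (hmem _ (Finset.mem_union_left _
        (Set.mem_toFinset.2 h))) (hcall _)
  have hS : S.IsComplete := by
    intro u v
    by_cases huv : v ∈ G.reachSet (fun a b => a < b) u
    · obtain ⟨p, hp⟩ := huv
      obtain ⟨t, ht⟩ : ∃ t, ∀ e ∈ p.edges.head?, t ≤ time e := by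
        cases p.edges.head? with
        | none => exact ⟨0, by simp⟩
        | some e => exact ⟨time e, by simp⟩
      exact ⟨t, hwalk u v p hp t ht⟩
    · refine ⟨_, _, CallScheme.Carries.of_call (t := time s(u, v)) (hmem _ ?_) (hcall _)⟩
      refine Finset.mem_union_right _ ?_
      simp only [U, Finset.mem_biUnion, Finset.mem_univ, true_and, Finset.mem_image,
        Set.mem_toFinset]
      exact ⟨u, v, huv, rfl⟩
  have h1 := CallScheme.gossip hL hS
  have h2 : S.times.card ≤ E.card := Finset.card_image_le
  have h3 : E.card ≤ _ := Finset.card_union_le _ _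
  have h4 : U.card ≤ ∑ u, ((G.reachSet (fun a b => a < b) u)ᶜ).ncard := by
    refine Finset.card_biUnion_le.trans (Finset.sum_le_sum fun u _ => ?_)
    rw [Set.ncard_eq_toFinset_card']
    exact Finset.card_image_le
  rw [← Set.ncard_eq_toFinset_card'] at h3
  omega

variable [DecidableEq V] {K : ℝ}

omit [Fintype V] [DecidableEq V] in
lemma agentCost_arbitraryLowStrict (s : Profile V) (u : V) :
    agentCost (arbitraryLowStrict V) K s u =
      (s u).card + K * ((s.toTemporalGraph.reachSet (fun a b => a < b) u)ᶜ).ncard := by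
  simp [agentCost, arbitraryLowStrict]

omit [DecidableEq V] in
lemma socialCost_arbitraryLowStrict (s : Profile V) :
    socialCost (arbitraryLowStrict V) K s = ((∑ u, (s u).card : ℕ) : ℝ) +
      K * ((∑ u, ((s.toTemporalGraph.reachSet (fun a b => a < b) u)ᶜ).ncard : ℕ) : ℝ) := by
  simp only [socialCost, agentCost_arbitraryLowStrict, Finset.sum_add_distrib, Nat.cast_sum,
    Finset.mul_sum]

lemma Profile.ncard_edgeSet_le (s : Profile V) :
    s.toTemporalGraph.graph.edgeSet.ncard ≤ ∑ u, (s u).card := by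
  let B : Finset (Sym2 V) := Finset.univ.biUnion fun u => (s u).image fun p => s(u, p.1)
  have hsub : s.toTemporalGraph.graph.edgeSet ⊆ B := by
    intro e he
    induction e using Sym2.ind with
    | _ a b =>
      rw [SimpleGraph.mem_edgeSet] at he
      obtain ⟨-, he⟩ := he
      simp only [B, Finset.coe_biUnion, Finset.coe_univ, Set.mem_univ, Set.iUnion_true,
        Set.mem_iUnion, Finset.coe_image, Set.mem_image, Finset.mem_coe]
      rcases he with ⟨l, hl⟩ | ⟨l, hl⟩
      · exact ⟨a, _, hl, rfl⟩
      · exact ⟨b, _, hl, Sym2.eq_swap⟩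
  have h := Set.ncard_le_ncard hsub (Finset.finite_toSet _)
  rw [Set.ncard_coe_finset] at h
  exact h.trans (Finset.card_biUnion_le.trans
    (Finset.sum_le_sum fun u _ => Finset.card_image_le))

/-- Every profile has social cost at least `2 n - 4`. -/
lemma le_socialCost (hK : 1 ≤ K) (s : Profile V) :
    2 * (Fintype.card V : ℝ) - 4 ≤ socialCost (arbitraryLowStrict V) K s := by
  rw [socialCost_arbitraryLowStrict]
  have h1 := s.toTemporalGraph.two_mul_card_le
  have h2 := s.ncard_edgeSet_le
  set d := ∑ u, ((s.toTemporalGraph.reachSet (fun a b => a < b) u)ᶜ).ncard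
  have h3 : ((2 * Fintype.card V : ℕ) : ℝ) ≤ ((∑ u, (s u).card + d + 4 : ℕ) : ℝ) := by
    exact_mod_cast (by omega)
  rw [Nat.cast_mul, Nat.cast_add, Nat.cast_add] at h3
  push_cast at h3 ⊢
  have h4 : (d : ℝ) ≤ K * d := le_mul_of_one_le_left (by positivity) hK
  linarith

end LowerBound

/-! ### Earliest arrivals and the cost of equilibria -/

section Equilibrium

variable {V : Type*}

/-- The labels bought for the pair `e`. -/
def Profile.bids (s : Profile V) (e : Sym2 V) : Set ℤ :=
  {l : ℤ | ∃ u v : V, s(u, v) = e ∧ (v, l) ∈ s u}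

lemma Profile.adj_iff {s : Profile V} {u v : V} :
    s.toTemporalGraph.graph.Adj u v ↔ u ≠ v ∧ (s.bids s(u, v)).Nonempty := by
  refine and_congr_right fun _ => ⟨?_, ?_⟩
  · rintro (⟨l, hl⟩ | ⟨l, hl⟩)
    · exact ⟨l, u, v, rfl, hl⟩
    · exact ⟨l, v, u, Sym2.eq_swap, hl⟩
  · rintro ⟨l, a, b, hab, hl⟩
    rcases Sym2.eq_iff.1 hab with ⟨rfl, rfl⟩ | ⟨rfl, rfl⟩
    · exact Or.inl ⟨l, hl⟩
    · exact Or.inr ⟨l, hl⟩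

lemma Profile.exists_lt_bids [Finite V] (s : Profile V) : ∃ B : ℤ, ∀ e, ∀ l ∈ s.bids e, B < l := by
  have hfin : (⋃ u : V, (Prod.snd '' (s u : Set (V × ℤ)))).Finite :=
    Set.finite_iUnion fun u => (s u).finite_toSet.image _
  obtain ⟨B, hB⟩ := hfin.bddBelow
  refine ⟨B - 1, ?_⟩
  rintro e l ⟨u, v, -, h⟩
  have := hB (Set.mem_iUnion.2 ⟨u, _, h, rfl⟩)
  simp only at this
  omega

lemma Profile.isLeast_label [Finite V] {s : Profile V} {e : Sym2 V} (h : (s.bids e).Nonempty) :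
    IsLeast (s.bids e) (s.toTemporalGraph.label e) := by
  obtain ⟨B, hB⟩ := s.exists_lt_bids
  have hb : BddBelow (s.bids e) := ⟨B, fun l hl => (hB e l hl).le⟩
  exact ⟨Int.csInf_mem h hb, fun l hl => csInf_le hb hl⟩

lemma Profile.label_eq {s : Profile V} {e : Sym2 V} {l : ℤ} (h : IsLeast (s.bids e) l) :
    s.toTemporalGraph.label e = l := h.csInf_eq

/-- Reachability by a strict temporal path all of whose labels are below `L`. -/
def TemporalGraph.ReachesBefore (G : TemporalGraph V) (u v : V) (L : ℤ) : Prop :=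
  ∃ p : G.graph.Walk u v, (p.edges.map G.label).IsChain (fun a b => a < b) ∧
    ∀ l ∈ p.edges.map G.label, l < L

namespace TemporalGraph

variable {G : TemporalGraph V}

lemma ReachesBefore.reaches {u v : V} {L : ℤ} (h : G.ReachesBefore u v L) :
    G.Reaches (fun a b => a < b) u v :=
  let ⟨p, hp, _⟩ := h
  ⟨p, hp⟩

lemma Reaches.exists_reachesBefore {u v : V} (h : G.Reaches (fun a b => a < b) u v) :
    ∃ L, G.ReachesBefore u v L := by
  obtain ⟨p, hp⟩ := h
  obtain ⟨L, hL⟩ := (p.edges.map G.label).finite_toSet.bddAbove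
  exact ⟨L + 1, p, hp, fun l hl => Int.lt_add_one_of_le (hL hl)⟩

lemma ReachesBefore.refl (u : V) (L : ℤ) : G.ReachesBefore u u L := ⟨.nil, by simp, by simp⟩

lemma ReachesBefore.step {u v w : V} {L : ℤ} (hvw : G.graph.Adj v w)
    (h : G.ReachesBefore u v (G.label s(v, w))) (hL : G.label s(v, w) < L) :
    G.ReachesBefore u w L := by
  obtain ⟨p, hp, hp'⟩ := h
  refine ⟨p.concat hvw, ?_, ?_⟩
  · rw [SimpleGraph.Walk.edges_concat, List.concat_eq_append, List.map_append,
      List.isChain_append]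
    refine ⟨hp, by simp, fun x hx y hy => ?_⟩
    simp only [List.map_cons, List.map_nil, List.head?_cons, Option.mem_def,
      Option.some.injEq] at hy
    exact hy ▸ hp' x (List.mem_of_mem_getLast? hx)
  · intro l hl
    rw [SimpleGraph.Walk.edges_concat, List.concat_eq_append, List.map_append,
      List.mem_append] at hl
    rcases hl with hl | hl
    · exact (hp' l hl).trans hL
    · simp only [List.map_cons, List.map_nil, List.mem_singleton] at hl
      exact hl ▸ hL

lemma ReachesBefore.exists_last {u w : V} {L : ℤ} (h : G.ReachesBefore u w L) (huw : u ≠ w) :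
    ∃ v, G.graph.Adj v w ∧ G.label s(v, w) < L ∧ G.ReachesBefore u v (G.label s(v, w)) := by
  obtain ⟨p, hp, hp'⟩ := h
  cases p with
  | nil => exact absurd rfl huw
  | cons h q =>
    obtain ⟨v, q', h', e⟩ := SimpleGraph.Walk.exists_cons_eq_concat h q
    rw [e, SimpleGraph.Walk.edges_concat, List.concat_eq_append, List.map_append] at hp hp'
    refine ⟨v, h', hp' _ (by simp), q', (List.isChain_append.1 hp).1, fun l hl => ?_⟩
    rw [List.isChain_iff_pairwise, List.pairwise_append] at hp
    exact hp.2.2 l hl _ (by simp)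

lemma Reaches.mono {G' : TemporalGraph V} {r : ℤ → ℤ → Prop}
    (h : ∀ a b, G.graph.Adj a b → G'.graph.Adj a b ∧ G'.label s(a, b) = G.label s(a, b))
    {u v : V} (huv : G.Reaches r u v) : G'.Reaches r u v := by
  obtain ⟨p, hp⟩ := huv
  have hle : G.graph ≤ G'.graph := fun a b hab => (h a b hab).1
  refine ⟨p.mapLe hle, ?_⟩
  rw [SimpleGraph.Walk.edges_mapLe_eq_edges, List.map_congr_left (g := G.label)]
  · exact hp
  · intro e he
    have he' := p.edges_subset_edgeSet he
    induction e using Sym2.ind with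
    | _ a b => exact (h a b he').2

/-- The tree of earliest arrivals from `r`: `π w` precedes `w` on it. -/
lemma exists_earliest_arrival_tree {r : V} [Finite V]
    (h : ∀ w, G.Reaches (fun a b => a < b) r w) :
    ∃ π : V → V, ∀ w, w ≠ r → G.graph.Adj (π w) w ∧
      (π w ≠ r → G.label s(π (π w), π w) < G.label s(π w, w)) := by
  have key : ∀ w, ∃ v, w ≠ r → G.graph.Adj v w ∧ G.ReachesBefore r v (G.label s(v, w)) ∧
      ∀ v', G.graph.Adj v' w → G.ReachesBefore r v' (G.label s(v', w)) →
        G.label s(v, w) ≤ G.label s(v', w) := by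
    intro w
    by_cases hw : w = r
    · exact ⟨w, fun h => absurd hw h⟩
    obtain ⟨L, hL⟩ := (h w).exists_reachesBefore
    obtain ⟨v, hv, -, hv'⟩ := hL.exists_last (Ne.symm hw)
    obtain ⟨v, ⟨h1, h2⟩, hmin⟩ := Set.exists_min_image
      {v | G.graph.Adj v w ∧ G.ReachesBefore r v (G.label s(v, w))}
      (fun v => G.label s(v, w)) (Set.toFinite _) ⟨v, hv, hv'⟩
    exact ⟨v, fun _ => ⟨h1, h2, fun v' h h' => hmin v' ⟨h, h'⟩⟩⟩
  choose π hπ using key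
  refine ⟨π, fun w hw => ⟨(hπ w hw).1, fun hne => ?_⟩⟩
  obtain ⟨v, h1, h2, h3⟩ := (hπ w hw).2.1.exists_last (Ne.symm hne)
  -- `π w` is entered from `v` before the edge to `w` opens, and its earliest entry is no later than
  -- this one.
  exact ((hπ _ hne).2.2 v h1 h3).trans_lt h2

end TemporalGraph

variable [Fintype V] [DecidableEq V] {K : ℝ}

omit [Fintype V] in
lemma IsNashEquilibrium.agentCost_le {s : Profile V}
    (hs : IsNashEquilibrium (arbitraryLowStrict V) K s) {u : V} {A : Finset (V × ℤ)}
    (h : ∀ w, (Profile.toTemporalGraph (Function.update s u A)).Reaches (fun a b => a < b) u w) :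
    agentCost (arbitraryLowStrict V) K s u ≤ A.card := by
  refine (not_lt.1 (hs u A)).trans ?_
  rw [agentCost_arbitraryLowStrict, Function.update_self, (_ : (TemporalGraph.reachSet _ _ u)ᶜ = ∅)]
  · simp
  · exact Set.compl_empty_iff.2 (Set.eq_univ_of_forall h)

/-- In an equilibrium everybody reaches everybody. -/
lemma IsNashEquilibrium.reaches {s : Profile V} (hK : 1 < K)
    (hs : IsNashEquilibrium (arbitraryLowStrict V) K s) (u v : V) :
    s.toTemporalGraph.Reaches (fun a b => a < b) u v := by
  by_contra hv
  have huv : u ≠ v := by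
    rintro rfl
    exact hv ⟨.nil, by simp⟩
  have hno : ∀ l, l ∉ s.bids s(u, v) := by
    intro l hl
    refine hv ⟨SimpleGraph.Walk.cons (Profile.adj_iff.2 ⟨huv, l, hl⟩) .nil, by simp⟩
  -- The pair was not bought at all, so the new edge changes no existing label, whatever its own; it
  -- costs 1 and saves at least K.
  refine hs u (insert (v, 0) (s u)) ?_
  rw [agentCost_arbitraryLowStrict, agentCost_arbitraryLowStrict, Function.update_self]
  set s' : Profile V := Function.update s u (insert (v, 0) (s u)) with hs'
  have hbids : ∀ e, e ≠ s(u, v) → s'.bids e = s.bids e := by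
    intro e he
    ext l
    refine exists_congr fun a => exists_congr fun b => and_congr_right fun hab => ?_
    by_cases ha : a = u
    · subst ha
      have hb : b ≠ v := by
        rintro rfl
        exact he hab.symm
      simp [hs', hb]
    · simp [hs', ha]
  have hmono : ∀ a b, s.toTemporalGraph.graph.Adj a b → s'.toTemporalGraph.graph.Adj a b ∧
      s'.toTemporalGraph.label s(a, b) = s.toTemporalGraph.label s(a, b) := by
    intro a b hab
    obtain ⟨hne, hbid⟩ := Profile.adj_iff.1 hab
    have he : s(a, b) ≠ s(u, v) := by
      intro he
      rw [he] at hbid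
      exact hno _ hbid.some_mem
    rw [← hbids _ he] at hbid
    refine ⟨Profile.adj_iff.2 ⟨hne, hbid⟩, Profile.label_eq ?_⟩
    rw [hbids _ he] at hbid ⊢
    exact Profile.isLeast_label hbid
  have hv' : s'.toTemporalGraph.Reaches (fun a b => a < b) u v := by
    refine ⟨SimpleGraph.Walk.cons (Profile.adj_iff.2 ⟨huv, 0, u, v, rfl, ?_⟩) .nil, by simp⟩
    simp [hs']
  have hlt : ((s'.toTemporalGraph.reachSet (fun a b => a < b) u)ᶜ).ncard <
      ((s.toTemporalGraph.reachSet (fun a b => a < b) u)ᶜ).ncard := by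
    refine Set.ncard_lt_ncard ⟨?_, ?_⟩ (Set.toFinite _)
    · exact Set.compl_subset_compl.2 fun w hw => TemporalGraph.Reaches.mono hmono hw
    · exact fun h => h (show v ∈ (s.toTemporalGraph.reachSet (fun a b => a < b) u)ᶜ from hv) hv'
  have hcard : ((insert (v, (0 : ℤ)) (s u)).card : ℝ) ≤ (s u).card + 1 := by
    exact_mod_cast Finset.card_insert_le _ _
  have hlt' : ((((s'.toTemporalGraph.reachSet (fun a b => a < b) u)ᶜ).ncard : ℕ) : ℝ) + 1 ≤
      ((s.toTemporalGraph.reachSet (fun a b => a < b) u)ᶜ).ncard := by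
    exact_mod_cast hlt
  nlinarith

/-- Buying very early access to `r` and keeping the own part of the tree of earliest arrivals
from `r` suffices to reach everybody. -/
lemma reaches_update {s : Profile V} {r u : V} {π α β : V → V} {B : ℤ} {A : Finset (V × ℤ)}
    (hB : ∀ e, ∀ l ∈ s.bids e, B < l)
    (hπ : ∀ w, w ≠ r → s.toTemporalGraph.graph.Adj (π w) w ∧
      (π w ≠ r → s.toTemporalGraph.label s(π (π w), π w) < s.toTemporalGraph.label s(π w, w)))
    (hαβ : ∀ w, w ≠ r → s(α w, β w) = s(π w, w) ∧
      (β w, s.toTemporalGraph.label s(π w, w)) ∈ s (α w))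
    (hA : ∀ w, w ≠ r → α w = u → (β w, s.toTemporalGraph.label s(π w, w)) ∈ A)
    (hA' : ∀ x ∈ A, x ∈ s u ∨ x = (r, B)) (hr : u ≠ r → (r, B) ∈ A) (w : V) :
    (Profile.toTemporalGraph (Function.update s u A)).Reaches (fun a b => a < b) u w := by
  set s' : Profile V := Function.update s u A with hs'
  have hsub : ∀ e, ∀ l ∈ s'.bids e, l ∈ s.bids e ∨ l = B ∧ e = s(u, r) := by
    rintro e l ⟨a, b, hab, h⟩
    by_cases ha : a = u
    · subst ha
      simp only [hs', Function.update_self] at h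
      rcases hA' _ h with h | h
      · exact Or.inl ⟨_, _, hab, h⟩
      · obtain ⟨rfl, rfl⟩ := Prod.ext_iff.1 h
        exact Or.inr ⟨rfl, hab.symm⟩
    · exact Or.inl ⟨a, b, hab, by simpa [hs', ha] using h⟩
  have hleast : ∀ w, w ≠ r → IsLeast (s.bids s(π w, w)) (s.toTemporalGraph.label s(π w, w)) :=
    fun w hw => Profile.isLeast_label (Profile.adj_iff.1 (hπ w hw).1).2
  -- The only possible new bid is `B` on the pair {u, r}, which for w ≠ r can only be the tree edge
  -- into u. Other tree edges keep their least bid.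
  have htree : ∀ w, w ≠ r → w ≠ u → s'.toTemporalGraph.graph.Adj (π w) w ∧
      s'.toTemporalGraph.label s(π w, w) = s.toTemporalGraph.label s(π w, w) := by
    intro w hwr hwu
    have hmem : s.toTemporalGraph.label s(π w, w) ∈ s'.bids s(π w, w) := by
      refine ⟨α w, β w, (hαβ w hwr).1, ?_⟩
      by_cases ha : α w = u
      · simpa [hs', ha] using hA w hwr ha
      · simpa [hs', ha] using (hαβ w hwr).2
    refine ⟨Profile.adj_iff.2 ⟨(hπ w hwr).1.ne, _, hmem⟩, Profile.label_eq ⟨hmem, ?_⟩⟩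
    intro l hl
    rcases hsub _ l hl with h | ⟨-, h⟩
    · exact (hleast w hwr).2 h
    · rw [Sym2.eq_iff] at h
      rcases h with ⟨-, h⟩ | ⟨-, h⟩
      · exact absurd h hwr
      · exact absurd h hwu
  have hroot : ∀ L, B < L → s'.toTemporalGraph.ReachesBefore u r L := by
    intro L hL
    by_cases hur : u = r
    · rw [← hur]
      exact .refl _ _
    have hmem : B ∈ s'.bids s(u, r) := ⟨u, r, rfl, by simpa [hs'] using hr hur⟩
    have hlab : s'.toTemporalGraph.label s(u, r) = B := by
      refine Profile.label_eq ⟨hmem, fun l hl => ?_⟩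
      rcases hsub _ l hl with h | ⟨h, -⟩
      · exact (hB _ l h).le
      · exact h.ge
    exact .step (Profile.adj_iff.2 ⟨hur, _, hmem⟩) (.refl _ _) (hlab ▸ hL)
  -- Induction on arrival labels follows the tree path back from w: it stops at u if it meets u, and
  -- otherwise at r, which u reaches with label `B`, below all tree labels.
  have key : ∀ w, w ≠ r → ∀ L, s.toTemporalGraph.label s(π w, w) < L →
      s'.toTemporalGraph.ReachesBefore u w L := by
    intro w
    let f : V → ℤ := fun w => s.toTemporalGraph.label s(π w, w)
    have hwf : WellFounded fun a b => f a < f b :=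
      @Finite.wellFounded_of_trans_of_irrefl _ _ (fun a b => f a < f b)
        ⟨fun _ _ _ h h' => lt_trans h h'⟩ ⟨fun _ => lt_irrefl _⟩
    induction w using hwf.induction with
    | _ w ih =>
      intro hwr L hL
      by_cases hwu : w = u
      · rw [hwu]
        exact .refl _ _
      obtain ⟨hadj, hlab⟩ := htree w hwr hwu
      refine .step hadj ?_ (hlab.symm ▸ hL)
      rw [hlab]
      by_cases hpr : π w = r
      · rw [hpr]
        exact hroot _ (hB _ _ (hpr ▸ (hleast w hwr).1))
      · exact ih _ ((hπ w hwr).2 hpr) hpr _ ((hπ w hwr).2 hpr)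
  by_cases hwr : w = r
  · exact hwr ▸ (hroot (B + 1) (by omega)).reaches
  · exact (key w hwr _ (lt_add_one _)).reaches

/-- Every equilibrium has social cost at most `2 n - 2`. -/
lemma IsNashEquilibrium.socialCost_le [Nonempty V] {s : Profile V} (hK : 1 < K)
    (hs : IsNashEquilibrium (arbitraryLowStrict V) K s) :
    socialCost (arbitraryLowStrict V) K s ≤ 2 * (Fintype.card V : ℝ) - 2 := by
  obtain ⟨r⟩ := ‹Nonempty V›
  obtain ⟨π, hπ⟩ := TemporalGraph.exists_earliest_arrival_tree (hs.reaches hK r)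
  obtain ⟨B, hB⟩ := s.exists_lt_bids
  have hown : ∀ w, ∃ a b, w ≠ r → s(a, b) = s(π w, w) ∧
      (b, s.toTemporalGraph.label s(π w, w)) ∈ s a := by
    intro w
    by_cases hw : w = r
    · exact ⟨w, w, fun h => absurd hw h⟩
    · obtain ⟨a, b, h⟩ := (Profile.isLeast_label (Profile.adj_iff.1 (hπ w hw).1).2).1
      exact ⟨a, b, fun _ => h⟩
  choose α β hαβ using hown
  -- The vertices whose tree edge is charged to u, a buyer at its least label.
  let W : V → Finset V := fun u => (Finset.univ.erase r).filter fun w => α w = u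
  have hcost : ∀ u, agentCost (arbitraryLowStrict V) K s u ≤
      (((W u).card + if u = r then 0 else 1 : ℕ) : ℝ) := by
    intro u
    let A : Finset (V × ℤ) := ((W u).image fun w => (β w, s.toTemporalGraph.label s(π w, w))) ∪
      if u = r then ∅ else {(r, B)}
    have hA : A.card ≤ (W u).card + if u = r then 0 else 1 := by
      refine (Finset.card_union_le _ _).trans (add_le_add Finset.card_image_le ?_)
      split_ifs <;> simp
    refine (hs.agentCost_le (A := A) (reaches_update hB hπ hαβ ?_ ?_ ?_)).trans
      (by exact_mod_cast hA)
    · intro w hw hα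
      exact Finset.mem_union_left _ (Finset.mem_image_of_mem _ (by simp [W, hw, hα]))
    · intro x hx
      rcases Finset.mem_union.1 hx with hx | hx
      · obtain ⟨w, hw, rfl⟩ := Finset.mem_image.1 hx
        simp only [W, Finset.mem_filter, Finset.mem_erase, Finset.mem_univ, and_true] at hw
        exact Or.inl (hw.2 ▸ (hαβ w hw.1).2)
      · split_ifs at hx
        · simp at hx
        · exact Or.inr (by simpa using hx)
    · intro hur
      exact Finset.mem_union_right _ (by simp [hur])
  have hsum : ∑ u, ((W u).card + if u = r then 0 else 1) + 2 = 2 * Fintype.card V := by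
    have h1 : ∑ u, (W u).card = (Finset.univ.erase r).card :=
      (Finset.card_eq_sum_card_fiberwise fun w _ => Finset.mem_univ (α w)).symm
    have h2 : ∑ u : V, (if u = r then 0 else 1) = (Finset.univ.erase r).card := by
      rw [Finset.card_eq_sum_ones, ← Finset.filter_ne', Finset.sum_filter]
      exact Finset.sum_congr rfl fun u _ => by by_cases h : u = r <;> simp [h]
    have h3 := Finset.card_erase_add_one (Finset.mem_univ r)
    rw [Finset.card_univ] at h3
    rw [Finset.sum_add_distrib, h1, h2]
    omega
  have h := Finset.sum_le_sum fun u (_ : u ∈ Finset.univ) => hcost u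
  rw [← Nat.cast_sum] at h
  have hsum' : ((∑ u, ((W u).card + if u = r then 0 else 1) : ℕ) : ℝ) + 2 =
      2 * (Fintype.card V : ℝ) := by exact_mod_cast hsum
  rw [socialCost]
  linarith

end Equilibrium

/-! ### Existence of extrema and the price of anarchy -/

section Extrema

variable {V : Type*} [Fintype V] [DecidableEq V] {K : ℝ}

omit [DecidableEq V] in
/-- Only finitely many social costs lie below a given bound. -/
lemma finite_socialCost_le (hK : 1 ≤ K) (C : ℝ) :
    {c | (∃ s : Profile V, socialCost (arbitraryLowStrict V) K s = c) ∧ c ≤ C}.Finite := by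
  -- A cost has the form m + K d with natural m and d; both are at most C because K ≥ 1.
  refine Set.Finite.subset (((Set.finite_Iic ⌈C⌉₊).prod (Set.finite_Iic ⌈C⌉₊)).image
    fun x : ℕ × ℕ => (x.1 : ℝ) + K * x.2) ?_
  rintro c ⟨⟨s, rfl⟩, hc⟩
  rw [socialCost_arbitraryLowStrict] at hc ⊢
  set m := ∑ u, (s u).card
  set d := ∑ u, ((s.toTemporalGraph.reachSet (fun a b => a < b) u)ᶜ).ncard
  have h1 : (d : ℝ) ≤ K * d := le_mul_of_one_le_left (by positivity) hK
  have h2 : (0 : ℝ) ≤ d := by positivity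
  have h3 : (0 : ℝ) ≤ m := by positivity
  have h4 := Nat.le_ceil C
  refine ⟨(m, d), ⟨?_, ?_⟩, rfl⟩
  · exact_mod_cast (by linarith : (m : ℝ) ≤ ⌈C⌉₊)
  · exact_mod_cast (by linarith : (d : ℝ) ≤ ⌈C⌉₊)

omit [DecidableEq V] in
lemma exists_isSocialOptimum (hK : 1 ≤ K) :
    ∃ o : Profile V, IsSocialOptimum (arbitraryLowStrict V) K o := by
  let s₀ : Profile V := fun _ => ∅
  obtain ⟨c, ⟨⟨o, rfl⟩, hoC⟩, hmin⟩ := Set.exists_min_image _ id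
    (finite_socialCost_le (V := V) hK (socialCost (arbitraryLowStrict V) K s₀))
    ⟨_, ⟨s₀, rfl⟩, le_rfl⟩
  refine ⟨o, fun s => ?_⟩
  rcases le_total (socialCost (arbitraryLowStrict V) K s)
    (socialCost (arbitraryLowStrict V) K s₀) with h | h
  · exact hmin _ ⟨⟨s, rfl⟩, h⟩
  · exact hoC.trans h

lemma exists_worst_equilibrium [Nonempty V] (hK : 1 < K)
    (h : ∃ s : Profile V, IsNashEquilibrium (arbitraryLowStrict V) K s) :
    ∃ s : Profile V, IsNashEquilibrium (arbitraryLowStrict V) K s ∧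
      ∀ s' : Profile V, IsNashEquilibrium (arbitraryLowStrict V) K s' →
        socialCost (arbitraryLowStrict V) K s' ≤ socialCost (arbitraryLowStrict V) K s := by
  obtain ⟨s₀, hs₀⟩ := h
  have hfin : {c | ∃ s : Profile V, IsNashEquilibrium (arbitraryLowStrict V) K s ∧
      socialCost (arbitraryLowStrict V) K s = c}.Finite := by
    refine (finite_socialCost_le (V := V) hK.le (2 * (Fintype.card V : ℝ) - 2)).subset ?_
    rintro c ⟨s, hs, rfl⟩
    exact ⟨⟨s, rfl⟩, hs.socialCost_le hK⟩
  obtain ⟨c, ⟨s, hs, rfl⟩, hmax⟩ := Set.exists_max_image _ id hfin ⟨_, s₀, hs₀, rfl⟩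
  exact ⟨s, hs, fun s' hs' => hmax _ ⟨s', hs', rfl⟩⟩

lemma priceOfAnarchy_le (hn : 3 ≤ Fintype.card V) (hK : 1 < K)
    (h : ∃ s : Profile V, IsNashEquilibrium (arbitraryLowStrict V) K s) :
    priceOfAnarchy (arbitraryLowStrict V) K ≤ 1 + 1 / ((Fintype.card V : ℝ) - 2) := by
  have : Nonempty V := Fintype.card_pos_iff.1 (by omega)
  have hn' : (3 : ℝ) ≤ Fintype.card V := by exact_mod_cast hn
  obtain ⟨s₀, hs₀⟩ := h
  have h1 : sSup {c : ℝ | ∃ s : Profile V, IsNashEquilibrium (arbitraryLowStrict V) K s ∧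
      socialCost (arbitraryLowStrict V) K s = c} ≤ 2 * (Fintype.card V : ℝ) - 2 := by
    refine csSup_le ⟨_, s₀, hs₀, rfl⟩ ?_
    rintro c ⟨s, hs, rfl⟩
    exact hs.socialCost_le hK
  have h2 : 2 * (Fintype.card V : ℝ) - 4 ≤
      sInf {c : ℝ | ∃ s : Profile V, socialCost (arbitraryLowStrict V) K s = c} := by
    refine le_csInf ⟨_, s₀, rfl⟩ ?_
    rintro c ⟨s, rfl⟩
    exact le_socialCost hK.le s
  rw [priceOfAnarchy]
  calc _ ≤ (2 * (Fintype.card V : ℝ) - 2) / (2 * (Fintype.card V : ℝ) - 4) :=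
        div_le_div₀ (by linarith) h1 (by linarith) h2
    _ = 1 + 1 / ((Fintype.card V : ℝ) - 2) := by
        have : (Fintype.card V : ℝ) - 2 ≠ 0 := by linarith
        have : 2 * (Fintype.card V : ℝ) - 4 ≠ 0 := by linarith
        field_simp
        ring

end Extrema

end TemporalGame

theorem mainTheorem11 {V : Type*} [Fintype V] [DecidableEq V] (hn : 3 ≤ Fintype.card V)
    (K : ℝ) (hK : 2 ≤ K) :
    (∃ o : TemporalGame.Profile V,
      TemporalGame.IsSocialOptimum (TemporalGame.arbitraryLowStrict V) K o ∧
        0 < TemporalGame.socialCost (TemporalGame.arbitraryLowStrict V) K o) ∧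
    ((∃ s : TemporalGame.Profile V,
      TemporalGame.IsNashEquilibrium (TemporalGame.arbitraryLowStrict V) K s) →
      (∃ s : TemporalGame.Profile V,
        TemporalGame.IsNashEquilibrium (TemporalGame.arbitraryLowStrict V) K s ∧
        ∀ s' : TemporalGame.Profile V,
          TemporalGame.IsNashEquilibrium (TemporalGame.arbitraryLowStrict V) K s' →
            TemporalGame.socialCost (TemporalGame.arbitraryLowStrict V) K s' ≤
              TemporalGame.socialCost (TemporalGame.arbitraryLowStrict V) K s) ∧
      TemporalGame.priceOfAnarchy (TemporalGame.arbitraryLowStrict V) K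
        ≤ 1 + 1 / ((Fintype.card V : ℝ) - 2)) := by
  have : Nonempty V := Fintype.card_pos_iff.1 (by omega)
  have hn' : (3 : ℝ) ≤ Fintype.card V := by exact_mod_cast hn
  have hK' : 1 < K := by linarith
  refine ⟨?_, fun h => ⟨TemporalGame.exists_worst_equilibrium hK' h,
    TemporalGame.priceOfAnarchy_le hn hK' h⟩⟩
  obtain ⟨o, ho⟩ := TemporalGame.exists_isSocialOptimum (V := V) hK'.le
  have := TemporalGame.le_socialCost hK'.le o
  exact ⟨o, ho, by linarith⟩
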